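/- **Conventions.** Let $R$ be a commutative ring. For sequences $b=(b_k)_{k\ge 0}$ and $\lambda=(\lambda_k)_{k\ge1}$ in $R$ let $p_n(x)\in R[x]$ be the monic polynomials $$p_{n+1}(x)=(x-b_n)p_n(x)-\lambda_n p_{n-1}(x),\qquad p_0(x)=1,\quad p_{-1}(x)=0 .$$ We say that $(p_n)$ has moments $(\mu_n)_{n\ge0}$, and write $\mu_n=\mu_n(b_k,\lambda_k)$, if there is exactly one $R$-linear functional $\mathcal L:R[x]\to R$ with $\mathcal L(1)=1$ and $\mathcal L(p_mp_n)=0$ for all $m\ne n$, and $\mathcal L(x^n)=\mu_n$ for all $n\ge 0$. For $X,Y\in R$ the Model II associated Laguerre polynomials $L^{(2)}_n(x;X,Y)$ are the $p_n$ with $$b_0=X,\qquad b_k=2k-1+X+Y\ \ (k>0),\qquad \lambda_k=(k-1+X)(k-1+Y)\ \ (k\ge 1).$$ For a permutation $\pi=\pi_1\cdots\pi_n\in\mathfrak S_n$, $\mathrm{RLmin}(\pi)$ is the number of right-to-left minima ($\pi_i$ with $\pi_i<\pi_j$ for all $j>i$), $\mathrm{LRmax}(\pi)$ is the number of left-to-right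 maxima ($\pi_i$ with $\pi_i>\pi_j$ for all $j<i$), and $\mathrm{pivot}(\pi)$ is the number of $\pi_i$ that are both. **Theorem.** 1. For every commutative ring $R$ and $X,Y\in R$, the polynomials $L^{(2)}_n(x;X,Y)$ have moments, and for all $n\ge0$ $$\mu_n=\sum_{\pi\in\mathfrak S_n}X^{\mathrm{RLmin}(\pi)}\,Y^{\mathrm{LRmax}(\pi)-\mathrm{pivot}(\pi)} .$$ 2. For every commutative ring $R$ and $X,Y,Z\in R$, the polynomials $p_n$ with $b_0=XYZ$, $b_k=2k-1+X+Y$ $(k>0)$ and $\lambda_k=(k-1+X)(k-1+Y)$ have moments, and for all $n\ge0$ $$\mu_n=\sum_{\pi\in\mathfrak S_n}X^{\mathrm{RLmin}(\pi)}\,Y^{\mathrm{LRmax}(\pi)}\,Z^{\mathrm{pivot}(\pi)} .$$ 3. Part 1 is the specialization $Z=1/Y$ of part 2: if $YZ=1$, then the polynomials of part 2 are the $L^{(2)}_n(x;X,Y)$, and the sum in part 2 equals the sum in part 1 for every $n$. 4. If $R=\mathbb R$ and $\mu$ is a Borel probability measure on $\mathbb R$ with finite moments of all orders for which the polynomials of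 part 1 (respectively part 2) are pairwise orthogonal, i.e. $\int p_mp_n\,d\mu=0$ for $m\neq n$, then $\int t^n\,d\mu(t)$ equals the sum in part 1 (respectively part 2) for every $n\ge0$. -/

import Mathlib

universe u

namespace AssocLaguerre

section Orthogonal

variable {R : Type*} [CommRing R]

/-- The monic polynomials given by the three term recurrence
`p_{n+1} = (x - b_n) p_n - lam_n p_{n-1}`, `p_0 = 1`, `p_{-1} = 0`
(so `lam 0` is never used). -/
noncomputable def orthoPoly (b lam : ℕ → R) : ℕ → Polynomial R
  | 0 => 1
  | 1 => Polynomial.X - Polynomial.C (b 0)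
  | n + 2 =>
      (Polynomial.X - Polynomial.C (b (n + 1))) * orthoPoly b lam (n + 1)
        - Polynomial.C (lam (n + 1)) * orthoPoly b lam n

/-- `L` is a (normalized) moment functional of a sequence `p` of polynomials: `L 1 = 1` and the
`p n` are pairwise orthogonal with respect to `L`.  The `n`-th moment is `L (x ^ n)`. -/
structure IsMomentFunctional (p : ℕ → Polynomial R) (L : Polynomial R →ₗ[R] R) : Prop where
  map_one : L 1 = 1
  orthogonal : ∀ m n : ℕ, m ≠ n → L (p m * p n) = 0

/-- The sequence `μ` is the sequence of moments of the polynomials `p`: the polynomials have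
exactly one normalized moment functional, and its value at `x ^ n` is `μ n` for every `n`. -/
def HasMoments (p : ℕ → Polynomial R) (μ : ℕ → R) : Prop :=
  (∃! L : Polynomial R →ₗ[R] R, IsMomentFunctional p L) ∧
    ∀ L : Polynomial R →ₗ[R] R, IsMomentFunctional p L →
      ∀ n : ℕ, L (Polynomial.X ^ n) = μ n

/-- The coefficients `lam_k = (k - 1 + X) (k - 1 + Y)`, for `k ≥ 1`. -/
def lagLam (X Y : R) (k : ℕ) : R := ((k : R) - 1 + X) * ((k : R) - 1 + Y)

/-- The coefficients `b_0 = B` and `b_k = 2 k - 1 + X + Y` for `k > 0`. -/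
def lagB (B X Y : R) (k : ℕ) : R := if k = 0 then B else 2 * (k : R) - 1 + X + Y

/-- The Model II associated Laguerre polynomials `L_n^{(2)}(x; X, Y)`:
`b_0 = X`, `b_n = 2 n - 1 + X + Y` for `n > 0`, `lam_n = (n - 1 + X) (n - 1 + Y)`. -/
noncomputable def modelII (X Y : R) : ℕ → Polynomial R :=
  orthoPoly (lagB X X Y) (lagLam X Y)

/-- The three parameter variant, with `b_0 = X Y Z` in place of `b_0 = X`. -/
noncomputable def modelXYZ (X Y Z : R) : ℕ → Polynomial R :=
  orthoPoly (lagB (X * Y * Z) X Y) (lagLam X Y)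

end Orthogonal

/-- `μ` is a (normalized) orthogonality measure on the line for the real polynomials `p`:
a probability measure with all moments finite for which the `p n` are pairwise orthogonal. -/
structure IsOrthogonalityMeasure (p : ℕ → Polynomial ℝ) (μ : MeasureTheory.Measure ℝ) :
    Prop where
  isProbabilityMeasure : MeasureTheory.IsProbabilityMeasure μ
  integrable_pow : ∀ n : ℕ, MeasureTheory.Integrable (fun t : ℝ => t ^ n) μ
  orthogonal : ∀ m n : ℕ, m ≠ n → ∫ t, (p m).eval t * (p n).eval t ∂μ = 0

section Permutations

variable {n : ℕ}

/-- The set of right-to-left minima `π_i` of the word `π_1 ⋯ π_n`. -/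
def RLMIN (π : Equiv.Perm (Fin n)) : Finset (Fin n) :=
  (Finset.univ.filter fun i : Fin n => ∀ j : Fin n, i < j → π i < π j).image π

/-- The set of left-to-right maxima `π_i` of the word `π_1 ⋯ π_n`. -/
def LRMAX (π : Equiv.Perm (Fin n)) : Finset (Fin n) :=
  (Finset.univ.filter fun i : Fin n => ∀ j : Fin n, j < i → π j < π i).image π

def RLmin (π : Equiv.Perm (Fin n)) : ℕ := (RLMIN π).card

def LRmax (π : Equiv.Perm (Fin n)) : ℕ := (LRMAX π).card

/-- The number of pivots: entries that are both a left-to-right maximum and a right-to-left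
minimum. -/
def pivot (π : Equiv.Perm (Fin n)) : ℕ := (LRMAX π ∩ RLMIN π).card

/-- The difference `LRmax π - pivot π` of natural numbers is never truncated. -/
theorem pivot_le_LRmax (π : Equiv.Perm (Fin n)) : pivot π ≤ LRmax π :=
  Finset.card_le_card Finset.inter_subset_left

end Permutations

/-- `∑_π X ^ RLmin(π) * Y ^ (LRmax(π) - pivot(π))`, over the permutations of `n` letters. -/
def modelIISum {R : Type*} [CommRing R] (X Y : R) (n : ℕ) : R :=
  ∑ π : Equiv.Perm (Fin n), X ^ RLmin π * Y ^ (LRmax π - pivot π)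

/-- `∑_π X ^ RLmin(π) * Y ^ LRmax(π) * Z ^ pivot(π)`, over the permutations of `n` letters. -/
def xyzSum {R : Type*} [CommRing R] (X Y Z : R) (n : ℕ) : R :=
  ∑ π : Equiv.Perm (Fin n), X ^ RLmin π * Y ^ LRmax π * Z ^ pivot π

end AssocLaguerre

/-! For a moment functional `L`, the three term recurrence makes the mixed moments `F n k = L (x ^ n
* p_k)` satisfy `F (n+1) k = F n (k+1) + b_k F n k + lam_k F n (k-1)`, without the last term when `k
= 0`, and orthogonality gives `F 0 k = δ_{k,0}`. These rules determine `F`. Conversely, any table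
obeying them yields a unique functional with moments `F n 0` (`IsMixedMomentTable.hasMoments`); no
division is needed, so any commutative ring will do.

The table is found combinatorially: `F n k` is the weighted sum over permutations of `n + k` letters
whose graph avoids the `k × k` corner square of small positions and small values. Enlarging the
square to side `k + 1` adds a hook, the new row and the new column. Either the hook is empty, or it
holds one point in the new column, or one in the new row, or one in each (`avoidSum_eq_add`).
Deleting these points leaves a permutation avoiding a square of side `k`, `k` or `k - 1`. Their
weights sum to `k + X` (to `B` if `k = 0`), `k - 1 + Y` and `(k - 1 + X) (k - 1 + Y)`, which
produces `b_k` and `lam_k`.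

Weights behave well because avoidance forces right-to-left minima to positions at least `k` and
left-to-right maxima to values at least `k`, so inserting hook points does not disturb them. At `k =
0` every permutation is allowed. Pivot weight `B = X` gives the first sum and `B = X * Y * Z` the
second. -/

namespace AssocLaguerre

/-! ### Moment functionals and tables of mixed moments. -/

section Polynomials

variable {R : Type*} [CommRing R]

theorem X_mul_orthoPoly_zero (b lam : ℕ → R) :
    Polynomial.X * orthoPoly b lam 0
      = orthoPoly b lam 1 + Polynomial.C (b 0) * orthoPoly b lam 0 := by
  simp [orthoPoly]

theorem X_mul_orthoPoly_succ (b lam : ℕ → R) (k : ℕ) :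
    Polynomial.X * orthoPoly b lam (k + 1)
      = orthoPoly b lam (k + 2) + Polynomial.C (b (k + 1)) * orthoPoly b lam (k + 1)
        + Polynomial.C (lam (k + 1)) * orthoPoly b lam k := by
  rw [orthoPoly]; ring

theorem map_C_mul (L : Polynomial R →ₗ[R] R) (a : R) (p : Polynomial R) :
    L (Polynomial.C a * p) = a * L p := by
  rw [← Polynomial.smul_eq_C_mul, map_smul, smul_eq_mul]

/-- A table `F n k` (meant as the values `L (x ^ n * p_k)`) that obeys the three term recurrence
with `F 0 k = δ_{k, 0}`. -/
structure IsMixedMomentTable (b lam : ℕ → R) (F : ℕ → ℕ → R) : Prop where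
  zero_zero : F 0 0 = 1
  zero_succ : ∀ k, F 0 (k + 1) = 0
  succ_zero : ∀ n, F (n + 1) 0 = F n 1 + b 0 * F n 0
  succ_succ : ∀ n k, F (n + 1) (k + 1)
    = F n (k + 2) + b (k + 1) * F n (k + 1) + lam (k + 1) * F n k

theorem map_X_pow_succ_mul_zero (b lam : ℕ → R) (L : Polynomial R →ₗ[R] R) (n : ℕ) :
    L (Polynomial.X ^ (n + 1) * orthoPoly b lam 0)
      = L (Polynomial.X ^ n * orthoPoly b lam 1)
        + b 0 * L (Polynomial.X ^ n * orthoPoly b lam 0) := by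
  rw [pow_succ, mul_assoc, X_mul_orthoPoly_zero, mul_add, map_add, mul_left_comm, map_C_mul]

theorem map_X_pow_succ_mul_succ (b lam : ℕ → R) (L : Polynomial R →ₗ[R] R) (n k : ℕ) :
    L (Polynomial.X ^ (n + 1) * orthoPoly b lam (k + 1))
      = L (Polynomial.X ^ n * orthoPoly b lam (k + 2))
        + b (k + 1) * L (Polynomial.X ^ n * orthoPoly b lam (k + 1))
        + lam (k + 1) * L (Polynomial.X ^ n * orthoPoly b lam k) := by
  rw [pow_succ, mul_assoc, X_mul_orthoPoly_succ, mul_add, mul_add, map_add, map_add,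
    mul_left_comm, map_C_mul, mul_left_comm, map_C_mul]

variable {b lam : ℕ → R} {F : ℕ → ℕ → R}

theorem IsMomentFunctional.map_X_pow_mul (hF : IsMixedMomentTable b lam F)
    {L : Polynomial R →ₗ[R] R} (hL : IsMomentFunctional (orthoPoly b lam) L) (n k : ℕ) :
    L (Polynomial.X ^ n * orthoPoly b lam k) = F n k := by
  induction n generalizing k with
  | zero =>
    cases k with
    | zero => simpa [orthoPoly, hF.zero_zero] using hL.map_one
    | succ k =>
      have := hL.orthogonal 0 (k + 1) (by omega)
      rw [orthoPoly, one_mul] at this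
      rw [pow_zero, one_mul, this, hF.zero_succ]
  | succ n ih =>
    cases k with
    | zero => rw [map_X_pow_succ_mul_zero, ih, ih, hF.succ_zero]
    | succ k => rw [map_X_pow_succ_mul_succ, ih, ih, ih, hF.succ_succ]

theorem IsMomentFunctional.map_X_pow (hF : IsMixedMomentTable b lam F)
    {L : Polynomial R →ₗ[R] R} (hL : IsMomentFunctional (orthoPoly b lam) L) (n : ℕ) :
    L (Polynomial.X ^ n) = F n 0 := by
  simpa [orthoPoly] using hL.map_X_pow_mul hF n 0

/-- The functional with prescribed values on the powers of `x`. -/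
noncomputable def functionalOfMoments (μ : ℕ → R) : Polynomial R →ₗ[R] R :=
  Polynomial.lsum fun n => (LinearMap.mulRight R (μ n))

theorem functionalOfMoments_X_pow (μ : ℕ → R) (n : ℕ) :
    functionalOfMoments μ (Polynomial.X ^ n) = μ n := by
  rw [functionalOfMoments, ← Polynomial.monomial_one_right_eq_X_pow, Polynomial.lsum_apply,
    Polynomial.sum_monomial_index] <;> simp

/-- Here column `0` of the table is known by construction, so the recurrence is solved for its
highest index and the induction runs on `k`; `IsMomentFunctional.map_X_pow_mul` starts from row `0`
and runs on `n`. -/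
theorem functionalOfMoments_X_pow_mul (hF : IsMixedMomentTable b lam F) (n k : ℕ) :
    functionalOfMoments (fun n => F n 0) (Polynomial.X ^ n * orthoPoly b lam k) = F n k := by
  induction k using Nat.strong_induction_on generalizing n with
  | _ k ih =>
    match k with
    | 0 => simp [orthoPoly, functionalOfMoments_X_pow]
    | 1 =>
      have h := map_X_pow_succ_mul_zero b lam (functionalOfMoments fun n => F n 0) n
      rw [ih 0 (by omega), ih 0 (by omega), hF.succ_zero] at h
      exact (add_right_cancel h).symm
    | k + 2 =>
      have h := map_X_pow_succ_mul_succ b lam (functionalOfMoments fun n => F n 0) n k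
      rw [ih (k + 1) (by omega), ih (k + 1) (by omega), ih k (by omega), hF.succ_succ] at h
      exact (add_right_cancel (add_right_cancel h)).symm

/-- If `L (p_k) = 0` for `k > 0`, then the polynomials `p_k` are pairwise orthogonal. -/
theorem map_orthoPoly_mul_eq_zero {L : Polynomial R →ₗ[R] R}
    (hL : ∀ k, L (orthoPoly b lam (k + 1)) = 0) (m n : ℕ) (h : m < n) :
    L (orthoPoly b lam m * orthoPoly b lam n) = 0 := by
  induction m using Nat.strong_induction_on generalizing n with
  | _ m ih =>
    match m with
    | 0 =>
      obtain ⟨n, rfl⟩ : ∃ k, n = k + 1 := ⟨n - 1, by omega⟩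
      rw [orthoPoly, one_mul, hL]
    | 1 =>
      obtain ⟨n, rfl⟩ : ∃ k, n = k + 2 := ⟨n - 2, by omega⟩
      have e : orthoPoly b lam 1 * orthoPoly b lam (n + 2)
          = orthoPoly b lam (n + 3) + Polynomial.C (b (n + 2)) * orthoPoly b lam (n + 2)
            + Polynomial.C (lam (n + 2)) * orthoPoly b lam (n + 1)
            - Polynomial.C (b 0) * orthoPoly b lam (n + 2) := by
        rw [← X_mul_orthoPoly_succ]; simp only [orthoPoly]; ring
      rw [e, map_sub, map_add, map_add, map_C_mul, map_C_mul, map_C_mul, hL, hL, hL]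
      simp
    | m + 2 =>
      obtain ⟨n, rfl⟩ : ∃ k, n = k + 1 := ⟨n - 1, by omega⟩
      -- Comparing the two expansions of `x * p_{m+1} * p_{n+1}` moves the factor `x` across and
      -- lowers the smaller index; every product on the right still has distinct indices in the same
      -- order.
      have e : orthoPoly b lam (m + 2) * orthoPoly b lam (n + 1)
          = orthoPoly b lam (m + 1) * orthoPoly b lam (n + 2)
            + Polynomial.C (b (n + 1)) * (orthoPoly b lam (m + 1) * orthoPoly b lam (n + 1))
            + Polynomial.C (lam (n + 1)) * (orthoPoly b lam (m + 1) * orthoPoly b lam n)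
            - Polynomial.C (b (m + 1)) * (orthoPoly b lam (m + 1) * orthoPoly b lam (n + 1))
            - Polynomial.C (lam (m + 1)) * (orthoPoly b lam m * orthoPoly b lam (n + 1)) := by
        have h1 := X_mul_orthoPoly_succ b lam n
        have h2 := X_mul_orthoPoly_succ b lam m
        linear_combination orthoPoly b lam (m + 1) * h1 - orthoPoly b lam (n + 1) * h2
      rw [e, map_sub, map_sub, map_add, map_add, map_C_mul, map_C_mul, map_C_mul, map_C_mul,
        ih (m + 1) (by omega) (n + 2) (by omega), ih (m + 1) (by omega) (n + 1) (by omega),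
        ih (m + 1) (by omega) n (by omega), ih m (by omega) (n + 1) (by omega)]
      simp

theorem isMomentFunctional_functionalOfMoments (hF : IsMixedMomentTable b lam F) :
    IsMomentFunctional (orthoPoly b lam) (functionalOfMoments fun n => F n 0) where
  map_one := by simpa [hF.zero_zero] using functionalOfMoments_X_pow (fun n => F n 0) 0
  orthogonal := by
    have key := map_orthoPoly_mul_eq_zero (b := b) (lam := lam)
      (L := functionalOfMoments fun n => F n 0)
      fun k => by simpa [hF.zero_succ] using functionalOfMoments_X_pow_mul hF 0 (k + 1)
    intro m n hmn
    rcases lt_or_gt_of_ne hmn with h | h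
    · exact key m n h
    · rw [mul_comm]; exact key n m h

theorem IsMixedMomentTable.hasMoments (hF : IsMixedMomentTable b lam F) :
    HasMoments (orthoPoly b lam) fun n => F n 0 := by
  refine ⟨⟨_, isMomentFunctional_functionalOfMoments hF, fun L hL => ?_⟩,
    fun L hL n => hL.map_X_pow hF n⟩
  refine Polynomial.lhom_ext' fun n => LinearMap.ext_ring ?_
  simp only [LinearMap.comp_apply, Polynomial.monomial_one_right_eq_X_pow]
  rw [hL.map_X_pow hF, functionalOfMoments_X_pow]

end Polynomials

/-! ### Orthogonality measures. -/

/-- The moments of an orthogonality measure are those of the moment functional. -/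
theorem integral_pow_eq_of_hasMoments {p : ℕ → Polynomial ℝ} {m : ℕ → ℝ} (hp : HasMoments p m)
    {μ : MeasureTheory.Measure ℝ} (hμ : IsOrthogonalityMeasure p μ) (n : ℕ) :
    ∫ t, t ^ n ∂μ = m n := by
  have := hμ.isProbabilityMeasure
  have hint : ∀ q : Polynomial ℝ, MeasureTheory.Integrable (fun t => q.eval t) μ := by
    intro q
    simp only [Polynomial.eval_eq_sum_range]
    exact MeasureTheory.integrable_finsetSum _ fun i _ => (hμ.integrable_pow i).const_mul _
  let L : Polynomial ℝ →ₗ[ℝ] ℝ :=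
    { toFun := fun q => ∫ t, q.eval t ∂μ
      map_add' := fun q r => by
        simp only [Polynomial.eval_add]
        exact MeasureTheory.integral_add (hint q) (hint r)
      map_smul' := fun c q => by
        simp only [Polynomial.eval_smul, smul_eq_mul, RingHom.id_apply]
        exact MeasureTheory.integral_const_mul c _ }
  have hL : IsMomentFunctional p L :=
    { map_one := by simp [L]
      orthogonal := fun i j hij => by simpa [L] using hμ.orthogonal i j hij }
  simpa [L] using hp.2 L hL n

/-! ### Inserting a point into a permutation graph, and avoidance of a corner square. -/

section InsertPoint

variable {n : ℕ}

/-- `π i` is a left-to-right maximum. -/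
def IsLRmaxAt (π : Equiv.Perm (Fin n)) (i : Fin n) : Prop := ∀ j, j < i → π j < π i

/-- `π i` is a right-to-left minimum. -/
def IsRLminAt (π : Equiv.Perm (Fin n)) (i : Fin n) : Prop := ∀ j, i < j → π i < π j

/-- Insert the point `(p, v)` into the graph of `σ`, shifting the other points away. -/
def insertPoint (p v : Fin (n + 1)) (σ : Equiv.Perm (Fin n)) : Equiv.Perm (Fin (n + 1)) :=
  ((finSuccEquiv' p).trans (Equiv.optionCongr σ)).trans (finSuccEquiv' v).symm

@[simp]
theorem insertPoint_self (p v : Fin (n + 1)) (σ : Equiv.Perm (Fin n)) :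
    insertPoint p v σ p = v := by
  simp [insertPoint]

@[simp]
theorem insertPoint_succAbove (p v : Fin (n + 1)) (σ : Equiv.Perm (Fin n)) (i : Fin n) :
    insertPoint p v σ (p.succAbove i) = v.succAbove (σ i) := by
  simp [insertPoint]

theorem insertPoint_injective (p : Fin (n + 1)) :
    Function.Injective fun x : Fin (n + 1) × Equiv.Perm (Fin n) => insertPoint p x.1 x.2 := by
  rintro ⟨v, σ⟩ ⟨w, τ⟩ h
  have hv : v = w := by simpa using DFunLike.congr_fun h p
  subst hv
  simp only [Prod.mk.injEq, true_and]
  ext1 i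
  simpa using DFunLike.congr_fun h (p.succAbove i)

theorem exists_insertPoint_eq (p : Fin (n + 1)) (π : Equiv.Perm (Fin (n + 1))) :
    ∃ σ, insertPoint p (π p) σ = π := by
  -- Surjectivity comes from counting: `(n + 1) * n! = (n + 1)!`.
  have hb := (Fintype.bijective_iff_injective_and_card _).2
    ⟨insertPoint_injective p, by simp [Fintype.card_perm, Nat.factorial_succ]⟩
  obtain ⟨⟨v, σ⟩, rfl⟩ := hb.2 π
  exact ⟨σ, by simp⟩

theorem val_succAbove (p : Fin (n + 1)) (i : Fin n) :
    (p.succAbove i : ℕ) = if (i : ℕ) < p then (i : ℕ) else i + 1 := by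
  simp only [Fin.succAbove, Fin.lt_def, Fin.val_castSucc]
  split_ifs <;> simp

theorem succAbove_lt_self_iff (p : Fin (n + 1)) (i : Fin n) :
    p.succAbove i < p ↔ (i : ℕ) < p := by
  rw [Fin.lt_def, val_succAbove]; split_ifs <;> omega

theorem self_lt_succAbove_iff (p : Fin (n + 1)) (i : Fin n) :
    p < p.succAbove i ↔ (p : ℕ) ≤ i := by
  rw [Fin.lt_def, val_succAbove]; split_ifs <;> omega

theorem isRLminAt_insertPoint_succAbove (p v : Fin (n + 1)) (σ : Equiv.Perm (Fin n)) (i : Fin n) :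
    IsRLminAt (insertPoint p v σ) (p.succAbove i)
      ↔ IsRLminAt σ i ∧ ((i : ℕ) < p → (σ i : ℕ) < v) := by
  simp only [IsRLminAt]
  rw [Fin.forall_iff_succAbove p]
  simp [succAbove_lt_self_iff, and_comm]

theorem isLRmaxAt_insertPoint_succAbove (p v : Fin (n + 1)) (σ : Equiv.Perm (Fin n)) (i : Fin n) :
    IsLRmaxAt (insertPoint p v σ) (p.succAbove i)
      ↔ IsLRmaxAt σ i ∧ ((p : ℕ) ≤ i → (v : ℕ) ≤ σ i) := by
  simp only [IsLRmaxAt]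
  rw [Fin.forall_iff_succAbove p]
  simp [self_lt_succAbove_iff, and_comm]

theorem isRLminAt_insertPoint_self (p v : Fin (n + 1)) (σ : Equiv.Perm (Fin n)) :
    IsRLminAt (insertPoint p v σ) p ↔ ∀ i : Fin n, (p : ℕ) ≤ i → (v : ℕ) ≤ σ i := by
  simp only [IsRLminAt]
  rw [Fin.forall_iff_succAbove p]
  simp [self_lt_succAbove_iff]

theorem isLRmaxAt_insertPoint_self (p v : Fin (n + 1)) (σ : Equiv.Perm (Fin n)) :
    IsLRmaxAt (insertPoint p v σ) p ↔ ∀ i : Fin n, (i : ℕ) < p → (σ i : ℕ) < v := by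
  simp only [IsLRmaxAt]
  rw [Fin.forall_iff_succAbove p]
  simp [succAbove_lt_self_iff]

/-- No position below `k` carries a value below `k`. -/
def Avoids (k : ℕ) (π : Equiv.Perm (Fin n)) : Prop := ∀ i : Fin n, (i : ℕ) < k → k ≤ (π i : ℕ)

theorem Avoids.le_of_apply_lt {k : ℕ} {π : Equiv.Perm (Fin n)} (h : Avoids k π) {i : Fin n}
    (hi : (π i : ℕ) < k) : k ≤ (i : ℕ) := by
  by_contra hc
  exact absurd (h i (by omega)) (by omega)

/-- The entry at position `0` is already at least `k`, and a left-to-right maximum cannot be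
smaller. -/
theorem Avoids.le_apply_of_isLRmaxAt {k : ℕ} {π : Equiv.Perm (Fin n)} (h : Avoids k π) {i : Fin n}
    (hi : IsLRmaxAt π i) : k ≤ (π i : ℕ) := by
  by_contra hc
  have hk := h.le_of_apply_lt (i := i) (by omega)
  have h0 := h ⟨0, i.pos⟩ (by simp only; omega)
  have := hi ⟨0, i.pos⟩ (by rw [Fin.lt_def]; simp only; omega)
  rw [Fin.lt_def] at this
  omega

theorem Avoids.exists_apply_eq_zero {k : ℕ} {π : Equiv.Perm (Fin n)} (h : Avoids k π)
    (hk : 0 < k) (hn : 0 < n) : ∃ i : Fin n, k ≤ (i : ℕ) ∧ (π i : ℕ) = 0 := by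
  refine ⟨π.symm ⟨0, hn⟩, h.le_of_apply_lt ?_, ?_⟩ <;> simp [hk]

/-- The value `0` sits at a position at least `k`, and no earlier position can hold a right-to-left
minimum. -/
theorem Avoids.le_of_isRLminAt {k : ℕ} {π : Equiv.Perm (Fin n)} (h : Avoids k π) {i : Fin n}
    (hi : IsRLminAt π i) : k ≤ (i : ℕ) := by
  by_contra hc
  obtain ⟨j, hj, hj0⟩ := h.exists_apply_eq_zero (by omega) i.pos
  have := hi j (by rw [Fin.lt_def]; omega)
  rw [Fin.lt_def] at this
  omega

theorem Avoids.forall_le_apply_iff {k : ℕ} {π : Equiv.Perm (Fin n)} (h : Avoids k π) (hn : k ≤ n)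
    {v : ℕ} (hv : v ≤ k) : (∀ i : Fin n, k ≤ (i : ℕ) → v ≤ π i) ↔ v = 0 := by
  refine ⟨fun H => ?_, fun H => by simp [H]⟩
  by_contra hv0
  obtain ⟨j, hj, hj0⟩ := h.exists_apply_eq_zero (by omega) (by omega)
  have := H j hj
  omega

theorem Avoids.forall_apply_lt_iff {k : ℕ} {π : Equiv.Perm (Fin n)} (h : Avoids k π) (hn : k ≤ n)
    {u : ℕ} (hu : u ≤ k) : (∀ i : Fin n, (i : ℕ) < u → (π i : ℕ) < k) ↔ u = 0 := by
  refine ⟨fun H => ?_, fun H => by simp [H]⟩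
  by_contra hu0
  have h1 := H ⟨0, by omega⟩ (by simp only; omega)
  have h2 := h ⟨0, by omega⟩ (by simp only; omega)
  omega

end InsertPoint

/-! ### Multiplicative weights and their change under insertion. -/

section Weight

open Classical in
/-- The weight of a point of the graph of `π`: pivots have weight `B`, other right-to-left minima
`X`, other left-to-right maxima `Y`, and all other points `1`. -/
noncomputable def pointWeight {R : Type*} [CommRing R] (B X Y : R) {n : ℕ}
    (π : Equiv.Perm (Fin n)) (i : Fin n) : R :=
  if IsRLminAt π i then (if IsLRmaxAt π i then B else X) else (if IsLRmaxAt π i then Y else 1)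

/-- The product of the weights of all points. -/
noncomputable def weight {R : Type*} [CommRing R] (B X Y : R) {n : ℕ}
    (π : Equiv.Perm (Fin n)) : R := ∏ i, pointWeight B X Y π i

variable {R : Type*} [CommRing R] {B X Y : R} {n : ℕ}

theorem pointWeight_congr {m : ℕ} {π : Equiv.Perm (Fin n)} {σ : Equiv.Perm (Fin m)} {i : Fin n}
    {j : Fin m} (h : IsRLminAt π i ↔ IsRLminAt σ j) (h' : IsLRmaxAt π i ↔ IsLRmaxAt σ j) :
    pointWeight B X Y π i = pointWeight B X Y σ j := by
  by_cases h1 : IsRLminAt σ j <;> by_cases h2 : IsLRmaxAt σ j <;> simp [pointWeight, h, h', h1, h2]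

theorem pointWeight_of_not_isRLminAt {π : Equiv.Perm (Fin n)} {i : Fin n} {P : Prop} [Decidable P]
    (h : ¬ IsRLminAt π i) (h' : IsLRmaxAt π i ↔ P) :
    pointWeight B X Y π i = if P then Y else 1 := by
  simp only [pointWeight, h, h', if_false]

theorem pointWeight_of_not_isLRmaxAt {π : Equiv.Perm (Fin n)} {i : Fin n} {P : Prop} [Decidable P]
    (h : ¬ IsLRmaxAt π i) (h' : IsRLminAt π i ↔ P) :
    pointWeight B X Y π i = if P then X else 1 := by
  simp only [pointWeight, h, h', if_false]

/-- The hypotheses say that the new point is neither below and to the right of an old right-to-left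
minimum nor above and to the left of an old left-to-right maximum, so every old point keeps its
status. -/
theorem weight_insertPoint {p v : Fin (n + 1)} {σ : Equiv.Perm (Fin n)}
    (hR : ∀ i, IsRLminAt σ i → (i : ℕ) < p → (σ i : ℕ) < v)
    (hL : ∀ i, IsLRmaxAt σ i → (p : ℕ) ≤ i → (v : ℕ) ≤ σ i) :
    weight B X Y (insertPoint p v σ)
      = pointWeight B X Y (insertPoint p v σ) p * weight B X Y σ := by
  rw [weight, Fin.prod_univ_succAbove _ p]
  congr 1
  refine Finset.prod_congr rfl fun i _ => pointWeight_congr ?_ ?_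
  · rw [isRLminAt_insertPoint_succAbove]; exact and_iff_left_of_imp (hR i)
  · rw [isLRmaxAt_insertPoint_succAbove]; exact and_iff_left_of_imp (hL i)

/-- Inserting a point at position `k`, of value `v ≤ k`. -/
theorem weight_insertPoint_position {k : ℕ} (hk : k < n + 1) {σ : Equiv.Perm (Fin n)}
    (hσ : Avoids k σ) {v : Fin (n + 1)} (hv : (v : ℕ) ≤ k) :
    weight B X Y (insertPoint ⟨k, hk⟩ v σ)
      = (if k = 0 then B else if (v : ℕ) = 0 then X else 1) * weight B X Y σ := by
  rw [weight_insertPoint]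
  · congr 1
    have hR : IsRLminAt (insertPoint ⟨k, hk⟩ v σ) ⟨k, hk⟩ ↔ (v : ℕ) = 0 := by
      rw [isRLminAt_insertPoint_self]; exact hσ.forall_le_apply_iff (by omega) hv
    have hL : IsLRmaxAt (insertPoint ⟨k, hk⟩ v σ) ⟨k, hk⟩ ↔ k = 0 := by
      rw [isLRmaxAt_insertPoint_self]
      refine ⟨fun H => (hσ.forall_apply_lt_iff (by omega) le_rfl).1
        fun i hi => lt_of_lt_of_le (H i hi) hv, fun H i hi => ?_⟩
      simp only at hi; omega
    rcases Nat.eq_zero_or_pos k with rfl | hk0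
    · have : (v : ℕ) = 0 := by omega
      rw [pointWeight, if_pos (hR.2 this), if_pos (hL.2 rfl), if_pos rfl]
    · rw [pointWeight_of_not_isLRmaxAt (by rw [hL]; omega) hR, if_neg (by omega : ¬ k = 0)]
  · intro i hi hlt
    have := hσ.le_of_isRLminAt hi
    simp only at hlt; omega
  · intro i hi _
    have := hσ.le_apply_of_isLRmaxAt hi
    omega

/-- Inserting a point of value `k` at a position `u < k`. -/
theorem weight_insertPoint_value {k : ℕ} (hk : k < n + 1) {σ : Equiv.Perm (Fin n)}
    (hσ : Avoids k σ) {u : Fin (n + 1)} (hu : (u : ℕ) < k) :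
    weight B X Y (insertPoint u ⟨k, hk⟩ σ)
      = (if (u : ℕ) = 0 then Y else 1) * weight B X Y σ := by
  rw [weight_insertPoint]
  · congr 1
    refine pointWeight_of_not_isRLminAt ?_ ?_
    · rw [isRLminAt_insertPoint_self]
      intro H
      obtain ⟨j, hj, hj0⟩ := hσ.exists_apply_eq_zero (by omega) (by omega)
      have := H j (by omega)
      simp only at this; omega
    · rw [isLRmaxAt_insertPoint_self]; exact hσ.forall_apply_lt_iff (by omega) hu.le
  · intro i hi hlt
    have := hσ.le_of_isRLminAt hi
    omega
  · intro i hi _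
    exact hσ.le_apply_of_isLRmaxAt hi

/-- Inserting points at the position `m + 1` (of value `v ≤ m`) and of the value `m + 1`
(at a position `u ≤ m`). -/
theorem weight_insertPoint_insertPoint {m : ℕ} (hm : m < n + 1) {τ : Equiv.Perm (Fin n)}
    (hτ : Avoids m τ) {u : Fin (n + 2)} {v : Fin (n + 1)} (hu : (u : ℕ) ≤ m) (hv : (v : ℕ) ≤ m) :
    weight B X Y (insertPoint u ⟨m + 1, by omega⟩ (insertPoint ⟨m, hm⟩ v τ))
      = (if (u : ℕ) = 0 then Y else 1) * (if (v : ℕ) = 0 then X else 1) * weight B X Y τ := by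
  -- `σ` does not avoid the square of side `m + 1`, so the one-point lemmas do not compose. The
  -- outer point lies above and to the left of the inner one, so it is no right-to-left minimum and
  -- the inner one is no left-to-right maximum. In particular, for `m = 0` the inner point is a
  -- pivot of `σ` but not of the result.
  set σ := insertPoint ⟨m, hm⟩ v τ with hσ
  have hσm : σ ⟨m, hm⟩ = v := by simp [hσ]
  rw [weight, Fin.prod_univ_succAbove _ u, Fin.prod_univ_succAbove _ ⟨m, hm⟩, ← mul_assoc]
  congr 1
  · congr 1
    · refine pointWeight_of_not_isRLminAt ?_ ?_
      · rw [isRLminAt_insertPoint_self]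
        intro H
        have := H ⟨m, hm⟩ hu
        rw [hσm] at this
        simp only at this; omega
      · rw [isLRmaxAt_insertPoint_self]
        refine ⟨fun H => ?_, fun H i hi => by omega⟩
        refine (hτ.forall_apply_lt_iff (by omega) hu).1 fun i hi => ?_
        have := H (Fin.succAbove ⟨m, hm⟩ i) (by rw [val_succAbove]; simp only; split_ifs <;> omega)
        rw [hσ, insertPoint_succAbove, val_succAbove] at this
        simp only at this
        split_ifs at this <;> omega
    · refine pointWeight_of_not_isLRmaxAt ?_ ?_
      · rw [isLRmaxAt_insertPoint_succAbove, hσm]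
        rintro ⟨-, H⟩
        have := H hu
        simp only at this; omega
      · rw [isRLminAt_insertPoint_succAbove, hσm, hσ, isRLminAt_insertPoint_self]
        rw [hτ.forall_le_apply_iff (by omega) hv]
        exact and_iff_left_of_imp fun _ h => by simp only at h; omega
  · refine Finset.prod_congr rfl fun i _ => pointWeight_congr ?_ ?_
    · rw [isRLminAt_insertPoint_succAbove, hσ, isRLminAt_insertPoint_succAbove, and_assoc]
      refine and_iff_left_of_imp fun h => ?_
      have := hτ.le_of_isRLminAt h
      rw [val_succAbove]
      simp only
      exact ⟨fun h => by omega, fun h => by split_ifs at h <;> omega⟩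
    · rw [isLRmaxAt_insertPoint_succAbove, hσ, isLRmaxAt_insertPoint_succAbove, and_assoc]
      refine and_iff_left_of_imp fun h => ?_
      have := hτ.le_apply_of_isLRmaxAt h
      rw [insertPoint_succAbove, val_succAbove v]
      simp only
      exact ⟨fun h => by omega, fun h => by split_ifs <;> omega⟩

end Weight

/-! ### The recurrence for sums over square-avoiding permutations, and the moments. -/

section Recurrence

variable {n : ℕ}

/-- The value at `k` is at most `k`, and all earlier positions carry values above `k`. -/
def ClosesPosition (k : Fin n) (π : Equiv.Perm (Fin n)) : Prop :=
  π k ≤ k ∧ ∀ i, i < k → k < π i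

/-- The value `k` sits before position `k`, all other positions up to `k` carry values above `k`. -/
def ClosesValue (k : Fin n) (π : Equiv.Perm (Fin n)) : Prop :=
  (∀ i, i ≤ k → k ≤ π i) ∧ ∃ u, u < k ∧ π u = k

/-- The value `k` sits before position `k`, which carries a value below `k`, and all other
positions up to `k` carry values above `k`. -/
def ClosesBoth (k : Fin n) (π : Equiv.Perm (Fin n)) : Prop :=
  (π k < k ∧ ∀ i, i < k → k ≤ π i) ∧ ∃ u, u < k ∧ π u = k

theorem closesPosition_insertPoint_iff {k v : Fin (n + 1)} {σ : Equiv.Perm (Fin n)} :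
    ClosesPosition k (insertPoint k v σ) ↔ v ≤ k ∧ Avoids k σ := by
  rw [ClosesPosition, Fin.forall_iff_succAbove k]
  simp only [insertPoint_self, insertPoint_succAbove, succAbove_lt_self_iff, lt_irrefl,
    false_imp_iff, true_and]
  refine and_congr_right fun hv => forall_congr' fun i => imp_congr_right fun hi => ?_
  rw [Fin.le_def] at hv
  rw [Fin.lt_def, val_succAbove]
  split_ifs <;> omega

theorem closesValue_insertPoint_iff {k u : Fin (n + 1)} (hu : u < k) {σ : Equiv.Perm (Fin n)} :
    ClosesValue k (insertPoint u k σ) ↔ Avoids k σ := by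
  have hE : ∃ w, w < k ∧ insertPoint u k σ w = k := ⟨u, hu, by simp⟩
  rw [ClosesValue, and_iff_left hE, Fin.forall_iff_succAbove u]
  simp only [insertPoint_self, insertPoint_succAbove, le_refl, implies_true, true_and]
  rw [Fin.lt_def] at hu
  refine forall_congr' fun i => ?_
  rw [Fin.le_def, Fin.le_def, val_succAbove, val_succAbove]
  split_ifs <;> omega

theorem closesBoth_insertPoint_iff {m : ℕ} (hm : m < n + 1) {u : Fin (n + 2)}
    (hu : (u : ℕ) ≤ m) {σ : Equiv.Perm (Fin (n + 1))} :
    ClosesBoth ⟨m + 1, by omega⟩ (insertPoint u ⟨m + 1, by omega⟩ σ)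
      ↔ ClosesPosition ⟨m, hm⟩ σ := by
  have hE : ∃ w, w < ⟨m + 1, by omega⟩ ∧ insertPoint u ⟨m + 1, by omega⟩ σ w = ⟨m + 1, by omega⟩ :=
    ⟨u, by rw [Fin.lt_def]; simp only; omega, by simp⟩
  have hK : (⟨m + 1, by omega⟩ : Fin (n + 2)) = u.succAbove ⟨m, hm⟩ := by
    ext; rw [val_succAbove]; simp only; split_ifs <;> omega
  rw [ClosesBoth, and_iff_left hE, Fin.forall_iff_succAbove u, ClosesPosition]
  simp only [insertPoint_self, insertPoint_succAbove, le_refl, implies_true, true_and]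
  refine and_congr ?_ (forall_congr' fun i => ?_)
  · conv_lhs => enter [1, 2]; rw [hK]
    rw [insertPoint_succAbove, Fin.lt_def, Fin.le_def, val_succAbove]
    simp only
    split_ifs <;> omega
  · rw [Fin.lt_def, Fin.lt_def, Fin.lt_def, Fin.le_def, val_succAbove, val_succAbove]
    simp only
    split_ifs <;> omega

variable {R : Type*} [CommRing R] {B X Y : R}

open Classical in
/-- The weighted sum over the permutations of `n` letters that avoid the `k × k` square. -/
noncomputable def avoidSum (B X Y : R) (n k : ℕ) : R :=
  ∑ π : Equiv.Perm (Fin n) with Avoids k π, weight B X Y π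

open Classical in
theorem sum_filter_eq_add {α : Type*} [Fintype α] {p q r : α → Prop} (f : α → R)
    (h : ∀ x, p x ↔ q x ∨ r x) (h' : ∀ x, q x → ¬ r x) :
    ∑ x with p x, f x = ∑ x with q x, f x + ∑ x with r x, f x := by
  rw [← Finset.sum_union (Finset.disjoint_filter.2 fun x _ => h' x), ← Finset.filter_or]
  simp only [h]

-- The split is first by whether the value `k` occurs before position `k`, then by whether position
-- `k` carries a value at most `k`. The corner cell of the hook is counted in `ClosesPosition`.
open Classical in
theorem avoidSum_eq_add (k : Fin n) :
    avoidSum B X Y n k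
      = avoidSum B X Y n (k + 1) + ∑ π with ClosesPosition k π, weight B X Y π
        + (∑ π with ClosesValue k π, weight B X Y π
          + ∑ π with ClosesBoth k π, weight B X Y π) := by
  have hne : ∀ π : Equiv.Perm (Fin n), (∃ u, u < k ∧ π u = k) → π k ≠ k := by
    rintro π ⟨u, hu, hπ⟩ hk
    exact hu.ne (π.injective (hπ.trans hk.symm))
  rw [avoidSum, sum_filter_eq_add (q := fun π => ∀ i, i < k → k < π i)
    (r := fun π => (∀ i, i < k → k ≤ π i) ∧ ∃ u, u < k ∧ π u = k)]
  · congr 1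
    · rw [avoidSum]
      refine sum_filter_eq_add _ (fun π => ?_) fun π h h' => ?_
      · constructor
        · intro h
          by_cases hk : π k ≤ k
          · exact Or.inr ⟨hk, h⟩
          · refine Or.inl fun i hi => ?_
            rcases eq_or_ne i k with rfl | hik
            · rw [Fin.le_def] at hk; omega
            · have := h i (by rw [Fin.lt_def]; have := Fin.val_ne_of_ne hik; omega)
              rw [Fin.lt_def] at this; omega
        · rintro (h | h) i hi
          · have := h i (by rw [Fin.lt_def] at hi; omega)
            rw [Fin.lt_def]; omega
          · exact h.2 i hi
      · have h1 := h k (by omega)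
        have h2 := h'.1
        rw [Fin.le_def] at h2; omega
    · refine sum_filter_eq_add _ (fun π => ?_) fun π h h' => ?_
      · rw [ClosesValue, ClosesBoth, ← or_and_right]
        refine and_congr_left fun hE => ⟨fun h => ?_, ?_⟩
        · rcases lt_or_gt_of_ne (hne π hE) with hk | hk
          · exact Or.inr ⟨hk, h⟩
          · refine Or.inl fun i hi => ?_
            rcases eq_or_lt_of_le hi with rfl | hi
            · exact hk.le
            · exact h i hi
        · rintro (h | h) i hi
          · exact h i hi.le
          · exact h.2 i hi
      · exact absurd (h.1 k le_rfl) (not_le.2 h'.1.1)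
  · intro π
    constructor
    · intro h
      by_cases hE : ∃ u, u < k ∧ π u = k
      · exact Or.inr ⟨fun i hi => h i hi, hE⟩
      · refine Or.inl fun i hi => lt_of_le_of_ne (h i hi) fun he => hE ⟨i, hi, he.symm⟩
    · rintro (h | h) i hi
      · exact (h i hi).le
      · exact h.1 i hi
  · rintro π h ⟨-, u, hu, hπ⟩
    exact (h u hu).ne hπ.symm

-- Common bijective counting scheme: `i` records where the deleted hook points were, and `c i` is
-- their total weight, independent of what remains.
open Classical in
theorem sum_weight_eq_mul_avoidSum {ι : Type*} [Fintype ι] {m k : ℕ}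
    {P : Equiv.Perm (Fin n) → Prop} (f : ι → Equiv.Perm (Fin m) → Equiv.Perm (Fin n)) (c : ι → R)
    (maps : ∀ i σ, Avoids k σ → P (f i σ))
    (inj : ∀ i j σ τ, f i σ = f j τ → i = j ∧ σ = τ)
    (surj : ∀ π, P π → ∃ i σ, Avoids k σ ∧ f i σ = π)
    (hw : ∀ i σ, Avoids k σ → weight B X Y (f i σ) = c i * weight B X Y σ) :
    ∑ π with P π, weight B X Y π = (∑ i, c i) * avoidSum B X Y m k := by
  rw [avoidSum, Finset.sum_mul_sum, ← Finset.sum_product']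
  symm
  refine Finset.sum_nbij (fun x => f x.1 x.2) ?_ ?_ ?_ ?_
  · rintro ⟨i, σ⟩ h
    simp only [Finset.mem_product, Finset.mem_filter, Finset.mem_univ, true_and] at h ⊢
    exact maps i σ h
  · rintro ⟨i, σ⟩ - ⟨j, τ⟩ - h
    exact Prod.ext_iff.2 (inj i j σ τ h)
  · intro π h
    obtain ⟨i, σ, hσ, rfl⟩ := surj π (by simpa using h)
    exact ⟨(i, σ), by simpa using hσ, rfl⟩
  · rintro ⟨i, σ⟩ h
    simp only [Finset.mem_product, Finset.mem_filter, Finset.mem_univ, true_and] at h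
    exact (hw i σ h).symm

/-- One known coordinate of the inserted point suffices, since the permutation determines the other.
-/
theorem insertPoint_inj {p q v w : Fin (n + 1)} {σ τ : Equiv.Perm (Fin n)}
    (h : insertPoint p v σ = insertPoint q w τ) (hpq : p = q ∨ v = w) :
    p = q ∧ v = w ∧ σ = τ := by
  have hp : p = q := by
    rcases hpq with hp | rfl
    · exact hp
    · refine (insertPoint q v τ).injective ?_
      rw [insertPoint_self, ← h, insertPoint_self]
  subst hp
  have := insertPoint_injective p (a₁ := (v, σ)) (a₂ := (w, τ)) h
  exact ⟨rfl, Prod.ext_iff.1 this⟩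

theorem exists_insertPoint_eq_of_apply_eq {p v : Fin (n + 1)} {π : Equiv.Perm (Fin (n + 1))}
    (h : π p = v) : ∃ σ, π = insertPoint p v σ := by
  obtain ⟨σ, hσ⟩ := exists_insertPoint_eq p π
  exact ⟨σ, by rw [← h, hσ]⟩

open Classical in
theorem sum_weight_closesPosition {k : ℕ} (hk : k < n + 1) :
    ∑ π with ClosesPosition (⟨k, hk⟩ : Fin (n + 1)) π, weight B X Y π
      = (∑ v : Fin (k + 1), if k = 0 then B else if (v : ℕ) = 0 then X else 1)
        * avoidSum B X Y n k := by
  refine sum_weight_eq_mul_avoidSum (fun v => insertPoint ⟨k, hk⟩ (v.castLE (by omega))) _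
    (fun v σ h => ?_) (fun v w σ τ h => ?_) (fun π h => ?_) fun v σ h => ?_
  · exact closesPosition_insertPoint_iff.2 ⟨by rw [Fin.le_def]; simp only [Fin.val_castLE]; omega, h⟩
  · obtain ⟨-, h1, h2⟩ := insertPoint_inj h (Or.inl rfl)
    exact ⟨Fin.castLE_injective _ h1, h2⟩
  · obtain ⟨σ, hσ⟩ := exists_insertPoint_eq_of_apply_eq (v := π ⟨k, hk⟩) rfl
    have hv := h.1
    rw [hσ] at h
    rw [Fin.le_def] at hv
    refine ⟨⟨π ⟨k, hk⟩, by simp only at hv; omega⟩, σ, (closesPosition_insertPoint_iff.1 h).2, ?_⟩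
    exact hσ.symm
  · exact weight_insertPoint_position hk h (by simp only [Fin.val_castLE]; omega)

open Classical in
theorem sum_weight_closesValue {k : ℕ} (hk : k < n + 1) :
    ∑ π with ClosesValue (⟨k, hk⟩ : Fin (n + 1)) π, weight B X Y π
      = (∑ u : Fin k, if (u : ℕ) = 0 then Y else 1) * avoidSum B X Y n k := by
  refine sum_weight_eq_mul_avoidSum (fun u => insertPoint (u.castLE (by omega)) ⟨k, hk⟩) _
    (fun u σ h => ?_) (fun u w σ τ h => ?_) (fun π h => ?_) fun u σ h => ?_
  · exact (closesValue_insertPoint_iff (by rw [Fin.lt_def]; simp only [Fin.val_castLE]; omega)).2 h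
  · obtain ⟨h1, -, h2⟩ := insertPoint_inj h (Or.inr rfl)
    exact ⟨Fin.castLE_injective _ h1, h2⟩
  · obtain ⟨-, u, hu, hπ⟩ := id h
    obtain ⟨σ, rfl⟩ := exists_insertPoint_eq_of_apply_eq hπ
    exact ⟨⟨u, hu⟩, σ, (closesValue_insertPoint_iff hu).1 h, rfl⟩
  · exact weight_insertPoint_value hk h (by simp only [Fin.val_castLE]; omega)

open Classical in
theorem sum_weight_closesBoth {m : ℕ} (hm : m < n + 1) :
    ∑ π with ClosesBoth (⟨m + 1, by omega⟩ : Fin (n + 2)) π, weight B X Y π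
      = (∑ u : Fin (m + 1), if (u : ℕ) = 0 then Y else 1)
        * (∑ v : Fin (m + 1), if (v : ℕ) = 0 then X else 1) * avoidSum B X Y n m := by
  rw [Finset.sum_mul_sum, ← Fintype.sum_prod_type']
  refine sum_weight_eq_mul_avoidSum (fun x τ => insertPoint (x.1.castLE (by omega))
    ⟨m + 1, by omega⟩ (insertPoint ⟨m, hm⟩ (x.2.castLE (by omega)) τ)) _
    (fun x σ h => ?_) (fun x y σ τ h => ?_) (fun π h => ?_) fun x σ h => ?_
  · refine (closesBoth_insertPoint_iff hm (by simp only [Fin.val_castLE]; omega)).2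
      (closesPosition_insertPoint_iff.2 ⟨?_, h⟩)
    rw [Fin.le_def]; simp only [Fin.val_castLE]; omega
  · obtain ⟨h1, -, h2⟩ := insertPoint_inj h (Or.inr rfl)
    obtain ⟨-, h3, h4⟩ := insertPoint_inj h2 (Or.inl rfl)
    exact ⟨Prod.ext (Fin.castLE_injective _ h1) (Fin.castLE_injective _ h3), h4⟩
  · obtain ⟨-, u, hu, hπ⟩ := id h
    obtain ⟨σ, rfl⟩ := exists_insertPoint_eq_of_apply_eq hπ
    rw [Fin.lt_def] at hu
    simp only at hu
    have h' := (closesBoth_insertPoint_iff hm (by omega)).1 h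
    obtain ⟨τ, hτ⟩ := exists_insertPoint_eq_of_apply_eq (v := σ ⟨m, hm⟩) rfl
    have hv := h'.1
    rw [hτ] at h'
    rw [Fin.le_def] at hv
    refine ⟨⟨⟨u, hu⟩, ⟨σ ⟨m, hm⟩, by simp only at hv; omega⟩⟩, τ,
      (closesPosition_insertPoint_iff.1 h').2, ?_⟩
    exact congrArg _ hτ.symm
  · exact weight_insertPoint_insertPoint hm h (by simp only [Fin.val_castLE]; omega)
      (by simp only [Fin.val_castLE]; omega)

theorem sum_ite_val_eq_zero (m : ℕ) (x : R) :
    ∑ v : Fin (m + 1), (if (v : ℕ) = 0 then x else 1) = m + x := by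
  simp [Fin.sum_univ_succ, add_comm]

open Classical in
theorem avoidSum_succ_zero (n : ℕ) :
    avoidSum B X Y (n + 1) 0 = avoidSum B X Y (n + 1) 1 + B * avoidSum B X Y n 0 := by
  have h := avoidSum_eq_add (B := B) (X := X) (Y := Y) (⟨0, by omega⟩ : Fin (n + 1))
  rw [sum_weight_closesPosition, sum_weight_closesValue] at h
  -- For `k = 0` the hook is a single cell: nothing lies below value `0`, and the sum for
  -- `ClosesValue` is indexed by `Fin 0`.
  have hB : ∀ π : Equiv.Perm (Fin (n + 1)), ¬ ClosesBoth ⟨0, by omega⟩ π := fun π h => by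
    have := h.1.1
    rw [Fin.lt_def] at this
    simp at this
  rw [Finset.filter_false_of_mem fun π _ => hB π] at h
  simpa using h

/-- With `k = m + 1`, the one-point cases contribute `k + X` and `k - 1 + Y`, which add up to `b_k`;
the two-point case contributes the product `lam_k`. -/
theorem avoidSum_succ_succ {n m : ℕ} (hm : m < n + 1) :
    avoidSum B X Y (n + 2) (m + 1)
      = avoidSum B X Y (n + 2) (m + 2)
        + lagB B X Y (m + 1) * avoidSum B X Y (n + 1) (m + 1)
        + lagLam X Y (m + 1) * avoidSum B X Y n m := by
  have h := avoidSum_eq_add (B := B) (X := X) (Y := Y) (⟨m + 1, by omega⟩ : Fin (n + 2))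
  rw [sum_weight_closesPosition, sum_weight_closesValue, sum_weight_closesBoth hm] at h
  simp only [sum_ite_val_eq_zero, Nat.add_eq_zero_iff,
    one_ne_zero, and_false, if_false] at h
  rw [h, lagB, if_neg (by omega), lagLam]
  push_cast
  ring

-- The square is the whole graph, so position `0` has no admissible value.
open Classical in
theorem avoidSum_self_succ (k : ℕ) : avoidSum B X Y (k + 1) (k + 1) = 0 := by
  rw [avoidSum, Finset.filter_false_of_mem, Finset.sum_empty]
  intro π _ h
  have := h 0 (by simp)
  omega

theorem avoidSum_zero_right (n : ℕ) : avoidSum B X Y n 0 = ∑ π : Equiv.Perm (Fin n), weight B X Y π := by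
  simp [avoidSum, Avoids]

theorem isMixedMomentTable_avoidSum (B X Y : R) :
    IsMixedMomentTable (lagB B X Y) (lagLam X Y) fun n k => avoidSum B X Y (n + k) k where
  zero_zero := by simp [avoidSum_zero_right, weight]
  zero_succ k := by rw [zero_add]; exact avoidSum_self_succ k
  succ_zero n := by simpa [lagB] using avoidSum_succ_zero n
  succ_succ n k := by
    rw [show n + 1 + (k + 1) = n + k + 2 by omega]
    exact avoidSum_succ_succ (by omega)

theorem hasMoments_sum_weight (B X Y : R) :
    HasMoments (orthoPoly (lagB B X Y) (lagLam X Y))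
      fun n => ∑ π : Equiv.Perm (Fin n), weight B X Y π := by
  simpa [avoidSum_zero_right] using (isMixedMomentTable_avoidSum B X Y).hasMoments

theorem apply_mem_RLMIN {π : Equiv.Perm (Fin n)} {i : Fin n} : π i ∈ RLMIN π ↔ IsRLminAt π i := by
  simp [RLMIN, IsRLminAt]

theorem apply_mem_LRMAX {π : Equiv.Perm (Fin n)} {i : Fin n} : π i ∈ LRMAX π ↔ IsLRmaxAt π i := by
  simp [LRMAX, IsLRmaxAt]

open Classical in
theorem pow_card_eq_prod (x : R) (π : Equiv.Perm (Fin n)) (s : Finset (Fin n)) :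
    x ^ s.card = ∏ i, if π i ∈ s then x else 1 := by
  rw [Equiv.prod_comp π fun j => if j ∈ s then x else 1]
  simp

theorem weight_eq_xyz (X Y Z : R) (π : Equiv.Perm (Fin n)) :
    weight (X * Y * Z) X Y π = X ^ RLmin π * Y ^ LRmax π * Z ^ pivot π := by
  rw [RLmin, LRmax, pivot, pow_card_eq_prod X π, pow_card_eq_prod Y π, pow_card_eq_prod Z π,
    ← Finset.prod_mul_distrib, ← Finset.prod_mul_distrib, weight]
  refine Finset.prod_congr rfl fun i _ => ?_
  have e1 := apply_mem_RLMIN (π := π) (i := i)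
  have e2 := apply_mem_LRMAX (π := π) (i := i)
  by_cases h1 : IsRLminAt π i <;> by_cases h2 : IsLRmaxAt π i <;>
    simp only [h1, h2, iff_true, iff_false] at e1 e2 <;> simp [pointWeight, h1, h2, e1, e2]

theorem weight_eq_modelII (X Y : R) (π : Equiv.Perm (Fin n)) :
    weight X X Y π = X ^ RLmin π * Y ^ (LRmax π - pivot π) := by
  -- With `B = X` a pivot contributes only to the power of `X`, so `Y` counts the left-to-right
  -- maxima that are not pivots.
  have hc : LRmax π - pivot π = (LRMAX π \ RLMIN π).card := by
    have := Finset.card_inter_add_card_sdiff (LRMAX π) (RLMIN π)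
    rw [LRmax, pivot]; omega
  rw [hc, RLmin, pow_card_eq_prod X π, pow_card_eq_prod Y π, ← Finset.prod_mul_distrib, weight]
  refine Finset.prod_congr rfl fun i _ => ?_
  have e1 := apply_mem_RLMIN (π := π) (i := i)
  have e2 := apply_mem_LRMAX (π := π) (i := i)
  by_cases h1 : IsRLminAt π i <;> by_cases h2 : IsLRmaxAt π i <;>
    simp only [h1, h2, iff_true, iff_false] at e1 e2 <;> simp [pointWeight, h1, h2, e1, e2]

theorem hasMoments_modelII (X Y : R) : HasMoments (modelII X Y) (modelIISum X Y) := by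
  have h := hasMoments_sum_weight X X Y
  simp only [weight_eq_modelII] at h
  exact h

theorem hasMoments_modelXYZ (X Y Z : R) : HasMoments (modelXYZ X Y Z) (xyzSum X Y Z) := by
  have h := hasMoments_sum_weight (X * Y * Z) X Y
  simp only [weight_eq_xyz] at h
  exact h

end Recurrence

end AssocLaguerre

theorem theorem3p3 :
    (∀ (R : Type u) [CommRing R] (X Y : R),
      AssocLaguerre.HasMoments (AssocLaguerre.modelII X Y) (AssocLaguerre.modelIISum X Y)) ∧
    (∀ (R : Type u) [CommRing R] (X Y Z : R),
      AssocLaguerre.HasMoments (AssocLaguerre.modelXYZ X Y Z) (AssocLaguerre.xyzSum X Y Z)) ∧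
    (∀ (R : Type u) [CommRing R] (X Y Z : R), Y * Z = 1 →
      AssocLaguerre.modelXYZ X Y Z = AssocLaguerre.modelII X Y ∧
      AssocLaguerre.xyzSum X Y Z = AssocLaguerre.modelIISum X Y) ∧
    (∀ (X Y : ℝ) (μ : MeasureTheory.Measure ℝ),
      AssocLaguerre.IsOrthogonalityMeasure (AssocLaguerre.modelII X Y) μ →
      ∀ n : ℕ, ∫ t, t ^ n ∂μ = AssocLaguerre.modelIISum X Y n) ∧
    (∀ (X Y Z : ℝ) (μ : MeasureTheory.Measure ℝ),
      AssocLaguerre.IsOrthogonalityMeasure (AssocLaguerre.modelXYZ X Y Z) μ →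
      ∀ n : ℕ, ∫ t, t ^ n ∂μ = AssocLaguerre.xyzSum X Y Z n) := by
  refine ⟨fun R _ X Y => AssocLaguerre.hasMoments_modelII X Y,
    fun R _ X Y Z => AssocLaguerre.hasMoments_modelXYZ X Y Z, fun R _ X Y Z h => ?_,
    fun X Y μ hμ => AssocLaguerre.integral_pow_eq_of_hasMoments
      (AssocLaguerre.hasMoments_modelII X Y) hμ,
    fun X Y Z μ hμ => AssocLaguerre.integral_pow_eq_of_hasMoments
      (AssocLaguerre.hasMoments_modelXYZ X Y Z) hμ⟩
  have hX : X * Y * Z = X := by rw [mul_assoc, h, mul_one]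
  refine ⟨by rw [AssocLaguerre.modelXYZ, AssocLaguerre.modelII, hX], funext fun n => ?_⟩
  refine Finset.sum_congr rfl fun π _ => ?_
  -- Both summands are the same weight once the pivot weights `X * Y * Z` and `X` agree.
  rw [← AssocLaguerre.weight_eq_xyz, ← AssocLaguerre.weight_eq_modelII, hX]
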